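/- Let $M$ be a real smooth or a complex manifold of finite dimension (in the complex case $TM$ is the holomorphic tangent bundle and all data are holomorphic), equipped with a smooth commutative associative product $\circ$ on the tangent spaces with unit vector field $e$, a vector field $E$, and a flat torsion-free connection $\nabla^{(1)}$ such that $$(\nabla^{(1)}_X\circ)(Y,Z)=(\nabla^{(1)}_Y\circ)(X,Z),\qquad \nabla^{(1)}e=0,\qquad [e,E]=e,\qquad \mathrm{Lie}_E\,\circ=\circ .$$ (These are the axioms of a Frobenius manifold without metric, except that $\nabla^{(1)}\nabla^{(1)}E=0$ is not assumed.) Suppose that $\circ$ is semisimple, i.e. near every point there are coordinates in which $c^i_{jk}=\delta^i_j\delta^i_k$, and that $E$ is invertible for $\circ$ at every point; put $X*Y=E^{-1}\circ X\circ Y$. A connection $\nabla^{(2)}$ on $TM$ is called a dual connection if 1. $\nabla^{(2)}E=0$; 2. $\nabla^{(2)}$ is compatible with $*$, i.e. $(\nabla^{(2)}_X*)(Y,Z)=(\nabla^{(2)}_Y*)(X,Z)$ for all $X,Y,Z$; 3. $\nabla^{(1)}$ and $\nabla^{(2)}$ are almost hydrodynamically equivalent: $(d_{\nabla^{(1)}}-d_{\nabla^{(2)}})(X\,\circ)=0$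 for every local vector field $X$, where $X\,\circ$ is the $TM$-valued $1$-form $Y\mapsto X\circ Y$ and $d_\nabla$ is the exterior covariant derivative. Then there is one and only one dual connection $\nabla^{(2)}$, so that it is uniquely determined by $\nabla^{(1)}$ (and $\circ$, $e$, $E$). Moreover, $\nabla^{(2)}$ is flat if and only if $\nabla^{(1)}\nabla^{(1)}E=0$, where $(\nabla\nabla E)(X,Y)=\nabla_X\nabla_YE-\nabla_{\nabla_XY}E$. -/

import Mathlib

open Bundle
open scoped Manifold ContDiff

noncomputable section

namespace AlmostDuality

variable {𝕜 : Type*} [RCLike 𝕜] {n : ℕ}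
  {M : Type*} [TopologicalSpace M] [ChartedSpace (Fin n → 𝕜) M]

variable (𝕜 n M) in
/-- The type of (not necessarily smooth) vector fields on `M`. Here and below `M` is a manifold of
dimension `n` over `𝕜`, where `𝕜` is `ℝ` or `ℂ`; over `ℂ` smooth means holomorphic and the tangent
bundle is the holomorphic tangent bundle. -/
abbrev VField : Type _ := (x : M) → TangentSpace 𝓘(𝕜, Fin n → 𝕜) x

variable (𝕜 n M) in
/-- A field of endomorphisms of the tangent bundle, i.e. a 1-form with values in `TM`. -/
abbrev EndField : Type _ :=
  (x : M) → TangentSpace 𝓘(𝕜, Fin n → 𝕜) x →L[𝕜] TangentSpace 𝓘(𝕜, Fin n → 𝕜) x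

variable (𝕜 n M) in
/-- A field of bilinear products on the tangent spaces, i.e. a tensor field of type `(1, 2)`. -/
abbrev ProductField : Type _ :=
  (x : M) → TangentSpace 𝓘(𝕜, Fin n → 𝕜) x →L[𝕜] TangentSpace 𝓘(𝕜, Fin n → 𝕜) x →L[𝕜]
    TangentSpace 𝓘(𝕜, Fin n → 𝕜) x

variable [IsManifold 𝓘(𝕜, Fin n → 𝕜) ∞ M]

variable (𝕜 n M) in
/-- An affine connection on `M`. The expression `cov Y x (X x)` is the value of `∇_X Y` at `x`. -/
abbrev AffineConnection : Type _ :=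
  CovariantDerivative 𝓘(𝕜, Fin n → 𝕜) (Fin n → 𝕜)
    (TangentSpace 𝓘(𝕜, Fin n → 𝕜) : M → Type _)

/-- The vector field `X` is smooth (holomorphic if `𝕜 = ℂ`) on the set `u`. -/
def SmoothVFieldOn (X : VField 𝕜 n M) (u : Set M) : Prop :=
  ContMDiffOn 𝓘(𝕜, Fin n → 𝕜) (𝓘(𝕜, Fin n → 𝕜).prod 𝓘(𝕜, Fin n → 𝕜)) ∞
    (fun x ↦ TotalSpace.mk' (Fin n → 𝕜) x (X x)) u

/-- The tensor field `mul` is smooth (holomorphic if `𝕜 = ℂ`): it maps smooth local vector fields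
to smooth local vector fields. -/
def SmoothProduct (mul : ProductField 𝕜 n M) : Prop :=
  ∀ u : Set M, IsOpen u → ∀ X Y : VField 𝕜 n M, SmoothVFieldOn X u → SmoothVFieldOn Y u →
    SmoothVFieldOn (fun x ↦ mul x (X x) (Y x)) u

/-- The connection is smooth (holomorphic if `𝕜 = ℂ`). The condition is imposed on local vector
fields, since a complex manifold may have too few global ones. -/
def SmoothConnection (cov : AffineConnection 𝕜 n M) : Prop :=
  ∀ u : Set M, IsOpen u → ContMDiffCovariantDerivativeOn (Fin n → 𝕜) ∞ cov.toFun u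

/-- The vector field `∇_X Y`. -/
def nabla (cov : AffineConnection 𝕜 n M) (X Y : VField 𝕜 n M) : VField 𝕜 n M :=
  fun x ↦ cov Y x (X x)

/-- The vector field `X ∘ Y`. -/
def prodV (mul : ProductField 𝕜 n M) (X Y : VField 𝕜 n M) : VField 𝕜 n M :=
  fun x ↦ mul x (X x) (Y x)

/-- The Lie bracket `[X, Y]`. -/
def bracket (X Y : VField 𝕜 n M) : VField 𝕜 n M :=
  VectorField.mlieBracket 𝓘(𝕜, Fin n → 𝕜) X Y

/-- `R(X, Y) Z = ∇_X ∇_Y Z - ∇_Y ∇_X Z - ∇_[X, Y] Z`. -/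
def curvature (cov : AffineConnection 𝕜 n M) (X Y Z : VField 𝕜 n M) : VField 𝕜 n M :=
  nabla cov X (nabla cov Y Z) - nabla cov Y (nabla cov X Z) - nabla cov (bracket X Y) Z

/-- The connection is flat: its curvature vanishes. -/
def IsFlat (cov : AffineConnection 𝕜 n M) : Prop :=
  ∀ u : Set M, IsOpen u → ∀ X Y Z : VField 𝕜 n M,
    SmoothVFieldOn X u → SmoothVFieldOn Y u → SmoothVFieldOn Z u →
      ∀ x ∈ u, curvature cov X Y Z x = 0

/-- The vector field `V` is flat (parallel): `∇ V = 0`. -/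
def IsParallel (cov : AffineConnection 𝕜 n M) (V : VField 𝕜 n M) : Prop :=
  ∀ x, cov V x = 0

/-- The second covariant derivative of `V`:
`(∇ ∇ V)(X, Y) = ∇_X ∇_Y V - ∇_(∇_X Y) V`. -/
def secondNabla (cov : AffineConnection 𝕜 n M) (V X Y : VField 𝕜 n M) : VField 𝕜 n M :=
  nabla cov X (nabla cov Y V) - nabla cov (nabla cov X Y) V

/-- The vector field `V` is linear with respect to the connection: `∇ ∇ V = 0`. -/
def IsLinearVField
    (cov : AffineConnection 𝕜 n M) (V : VField 𝕜 n M) : Prop :=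
  ∀ u : Set M, IsOpen u → ∀ X Y : VField 𝕜 n M, SmoothVFieldOn X u → SmoothVFieldOn Y u →
    ∀ x ∈ u, secondNabla cov V X Y x = 0

/-- The covariant derivative of the product:
`(∇_X ∘)(Y, Z) = ∇_X (Y ∘ Z) - (∇_X Y) ∘ Z - Y ∘ (∇_X Z)`. -/
def nablaProd (cov : AffineConnection 𝕜 n M) (mul : ProductField 𝕜 n M)
    (X Y Z : VField 𝕜 n M) : VField 𝕜 n M :=
  nabla cov X (prodV mul Y Z) - prodV mul (nabla cov X Y) Z - prodV mul Y (nabla cov X Z)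

/-- The connection is compatible with the product: `(∇_X ∘)(Y, Z) = (∇_Y ∘)(X, Z)`, i.e.
`∇_k c^i_{jl} = ∇_j c^i_{kl}` for the structure constants `c` of the product. -/
def IsCompatible
    (cov : AffineConnection 𝕜 n M) (mul : ProductField 𝕜 n M) : Prop :=
  ∀ u : Set M, IsOpen u → ∀ X Y Z : VField 𝕜 n M,
    SmoothVFieldOn X u → SmoothVFieldOn Y u → SmoothVFieldOn Z u →
      ∀ x ∈ u, nablaProd cov mul X Y Z x = nablaProd cov mul Y X Z x

/-- The Lie derivative of the product:
`(Lie_E ∘)(X, Y) = [E, X ∘ Y] - [E, X] ∘ Y - X ∘ [E, Y]`. -/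
def lieProd (E : VField 𝕜 n M) (mul : ProductField 𝕜 n M) (X Y : VField 𝕜 n M) : VField 𝕜 n M :=
  bracket E (prodV mul X Y) - prodV mul (bracket E X) Y - prodV mul X (bracket E Y)

/-- The exterior covariant derivative of a `TM`-valued 1-form `φ`:
`(d_∇ φ)(Y, Z) = ∇_Y (φ Z) - ∇_Z (φ Y) - φ [Y, Z]`. -/
def extCovDeriv (cov : AffineConnection 𝕜 n M) (φ : EndField 𝕜 n M) (Y Z : VField 𝕜 n M) :
    VField 𝕜 n M :=
  nabla cov Y (fun x ↦ φ x (Z x)) - nabla cov Z (fun x ↦ φ x (Y x)) -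
    fun x ↦ φ x (bracket Y Z x)

/-- Almost hydrodynamical equivalence of two connections with respect to a product:
`(d_∇₁ - d_∇₂)(X ∘) = 0` for every vector field `X`. -/
def AlmostHydroEquiv
    (cov₁ cov₂ : AffineConnection 𝕜 n M) (mul : ProductField 𝕜 n M) : Prop :=
  ∀ u : Set M, IsOpen u → ∀ X Y Z : VField 𝕜 n M,
    SmoothVFieldOn X u → SmoothVFieldOn Y u → SmoothVFieldOn Z u →
      ∀ x ∈ u, extCovDeriv cov₁ (fun y ↦ mul y (X y)) Y Z x
        - extCovDeriv cov₂ (fun y ↦ mul y (X y)) Y Z x = 0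

/-- The coordinate vector field `∂/∂u^i` of the chart `φ = (u^1, …, u^n)`. -/
def coordVField (φ : OpenPartialHomeomorph M (Fin n → 𝕜)) (i : Fin n) : VField 𝕜 n M :=
  VectorField.mpullback 𝓘(𝕜, Fin n → 𝕜) 𝓘(𝕜, Fin n → 𝕜) φ (fun _ ↦ Pi.single i (1 : 𝕜))

/-- The product is semisimple: near every point there are canonical coordinates, in which
`c^i_{jk} = δ^i_j δ^i_k`. -/
def IsSemisimple (mul : ProductField 𝕜 n M) : Prop :=
  ∀ x : M, ∃ φ ∈ IsManifold.maximalAtlas 𝓘(𝕜, Fin n → 𝕜) ∞ M, x ∈ φ.source ∧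
    ∀ y ∈ φ.source, ∀ j k : Fin n,
      mul y (coordVField φ j y) (coordVField φ k y) = if j = k then coordVField φ j y else 0

variable (𝕜 n M) in
/-- The axioms of a Frobenius manifold without metric `(M, ∘, ∇, e, E)`, with the exception of the
linearity `∇ ∇ E = 0` of the Euler vector field. -/
structure FlatFManifoldWithEuler where
  /-- the product `∘` -/
  mul : ProductField 𝕜 n M
  /-- the unit vector field -/
  e : VField 𝕜 n M
  /-- the Euler vector field -/
  E : VField 𝕜 n M
  /-- the natural connection `∇^(1)` -/
  conn : AffineConnection 𝕜 n M
  smooth_mul : SmoothProduct mul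
  smooth_e : SmoothVFieldOn e Set.univ
  smooth_E : SmoothVFieldOn E Set.univ
  smooth_conn : SmoothConnection conn
  mul_comm : ∀ x v w, mul x v w = mul x w v
  mul_assoc : ∀ x v w z, mul x (mul x v w) z = mul x v (mul x w z)
  e_mul : ∀ x v, mul x (e x) v = v
  torsion_free : conn.torsion = 0
  flat : IsFlat conn
  compatible : IsCompatible conn mul
  e_parallel : IsParallel conn e
  e_bracket : bracket e E = e
  lie_E_mul : ∀ u : Set M, IsOpen u → ∀ X Y : VField 𝕜 n M,
    SmoothVFieldOn X u → SmoothVFieldOn Y u → ∀ x ∈ u, lieProd E mul X Y x = prodV mul X Y x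

namespace FlatFManifoldWithEuler

variable (F : FlatFManifoldWithEuler 𝕜 n M)

/-- The Euler vector field is invertible for the product at every point. -/
def EulerInvertible : Prop := ∀ x, ∃ v, F.mul x (F.E x) v = F.e x

open Classical in
/-- The inverse `E⁻¹` of the Euler vector field for the product (`0` where there is none). -/
def eulerInv : VField 𝕜 n M :=
  fun x ↦ if h : ∃ v, F.mul x (F.E x) v = F.e x then h.choose else 0

/-- The dual product `X * Y = E⁻¹ ∘ X ∘ Y`. -/
def dualMul : ProductField 𝕜 n M :=
  fun x ↦ (F.mul x).comp (F.mul x (F.eulerInv x))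

theorem dualMul_apply (x : M) (v w : TangentSpace 𝓘(𝕜, Fin n → 𝕜) x) :
    F.dualMul x v w = F.mul x (F.mul x (F.eulerInv x) v) w := rfl

/-- `cov` is a dual connection `∇^(2)`. -/
structure IsDualConnection (cov : AffineConnection 𝕜 n M) : Prop where
  smooth : SmoothConnection cov
  E_parallel : IsParallel cov F.E
  compatible : IsCompatible cov F.dualMul
  almostHydroEquiv : AlmostHydroEquiv F.conn cov F.mul

end FlatFManifoldWithEuler

end AlmostDuality

end

noncomputable section

namespace AlmostDuality

variable {𝕜 : Type*} [RCLike 𝕜] {n : ℕ}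
  {M : Type*} [TopologicalSpace M] [ChartedSpace (Fin n → 𝕜) M]
  [IsManifold 𝓘(𝕜, Fin n → 𝕜) ∞ M]

/-! The dual connection is explicit: `∇²_X Y = ∇_X Y - ∇_(X * Y) E`. It kills `E` because `X * E =
X`. It is almost hydrodynamically equivalent to `∇` because the correction `∇_(Y * (X ∘ Z)) E` is
symmetric in `Y`, `Z`. Compatibility with `*` is the hard condition (`dualConnection_compatible`):
it combines the total symmetry of `∇∘`, the cocycle identity forced by associativity
(`nablaProd_cocycle`), and `Lie_E ∘ = ∘` rewritten as a rule for `∇_(X ∘ Y) E` (`nabla_prodV_E`).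

Uniqueness is linear algebra on the difference tensor `A` of two dual connections: `A(a ∘ c) b = A(a
∘ b) c` and `A(E) = 0` force `A = 0`, since `E` is invertible.

Compatibility and flatness of `∇` give `R²(X, Y) Z = (∇∇E)(Y, X * Z) - (∇∇E)(X, Y * Z)`. Since
`(∇∇E)(e, ·) = 0`, the choice `Y = e` recovers `∇∇E` from `R²`. -/

/-! ### Smooth local vector fields and endomorphism fields. -/

theorem SmoothVFieldOn.mono {X : VField 𝕜 n M} {u v : Set M} (hX : SmoothVFieldOn X u)
    (h : v ⊆ u) : SmoothVFieldOn X v :=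
  ContMDiffOn.mono hX h

theorem SmoothVFieldOn.mdifferentiableAt {X : VField 𝕜 n M} {u : Set M} (hX : SmoothVFieldOn X u)
    (hu : IsOpen u) {x : M} (hx : x ∈ u) :
    MDifferentiableAt 𝓘(𝕜, Fin n → 𝕜) (𝓘(𝕜, Fin n → 𝕜).prod 𝓘(𝕜, Fin n → 𝕜))
      (fun y ↦ TotalSpace.mk' (Fin n → 𝕜) y (X y)) x :=
  (ContMDiffOn.contMDiffAt hX (hu.mem_nhds hx)).mdifferentiableAt (by simp)

theorem SmoothVFieldOn.sub {X Y : VField 𝕜 n M} {u : Set M} (hX : SmoothVFieldOn X u)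
    (hY : SmoothVFieldOn Y u) : SmoothVFieldOn (X - Y) u :=
  ContMDiffOn.sub_section hX hY

/-- A tangent vector extends to a vector field which is smooth near its base point. -/
theorem exists_smoothVFieldOn_eq (x : M) (v : TangentSpace 𝓘(𝕜, Fin n → 𝕜) x) :
    ∃ u : Set M, IsOpen u ∧ x ∈ u ∧ ∃ X : VField 𝕜 n M, SmoothVFieldOn X u ∧ X x = v := by
  obtain ⟨s, hs, h⟩ := FiberBundle.exists_contMDiffOn_extend (k := ∞) 𝓘(𝕜, Fin n → 𝕜)
    (Fin n → 𝕜) v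
  obtain ⟨u, hus, hu, hx⟩ := mem_nhds_iff.mp hs
  exact ⟨u, hu, hx, FiberBundle.extend (Fin n → 𝕜) v, h.mono hus, by simp⟩

/-- A field of endomorphisms which maps smooth local vector fields to smooth ones is smooth as
a section of the bundle of endomorphisms. -/
theorem contMDiffOn_endField {φ : EndField 𝕜 n M} {u : Set M} (hu : IsOpen u)
    (h : ∀ v : Set M, v ⊆ u → IsOpen v → ∀ X : VField 𝕜 n M, SmoothVFieldOn X v →
      SmoothVFieldOn (fun x ↦ φ x (X x)) v) :
    ContMDiffOn 𝓘(𝕜, Fin n → 𝕜)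
      (𝓘(𝕜, Fin n → 𝕜).prod 𝓘(𝕜, (Fin n → 𝕜) →L[𝕜] (Fin n → 𝕜))) ∞
      (fun x ↦ (⟨x, φ x⟩ : TotalSpace ((Fin n → 𝕜) →L[𝕜] (Fin n → 𝕜))
        fun x ↦ TangentSpace 𝓘(𝕜, Fin n → 𝕜) x →L[𝕜] TangentSpace 𝓘(𝕜, Fin n → 𝕜) x)) u := by
  intro x₀ hx₀
  apply ContMDiffAt.contMDiffWithinAt
  rw [contMDiffAt_hom_bundle]
  refine ⟨contMDiffAt_id, ?_⟩
  set t := trivializationAt (Fin n → 𝕜) (TangentSpace 𝓘(𝕜, Fin n → 𝕜) : M → Type _) x₀ with ht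
  have hx₀t : x₀ ∈ t.baseSet := FiberBundle.mem_baseSet_trivializationAt' x₀
  -- The columns of the matrix of `φ` at `x`: images of the local frame given by the trivialization.
  have key : ∀ i : Fin n, ContMDiffAt 𝓘(𝕜, Fin n → 𝕜) 𝓘(𝕜, Fin n → 𝕜) ∞
      (fun x ↦ (t ⟨x, φ x (t.symmL 𝕜 x (Pi.single i 1))⟩).2) x₀ := by
    intro i
    refine (contMDiffAt_section (s := fun x ↦ φ x (t.symmL 𝕜 x (Pi.single i 1))) x₀).mp ?_
    have hs : SmoothVFieldOn (𝕜 := 𝕜) (n := n) (M := M)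
        (fun x ↦ t.symmL 𝕜 x (Pi.single i 1)) t.baseSet := by
      intro x hx
      rw [t.contMDiffWithinAt_section _ hx]
      refine (contMDiffOn_const (c := (Pi.single i 1 : Fin n → 𝕜))).congr (fun y hy ↦ ?_) x hx
      rw [t.symmL_apply hy]
      exact congrArg Prod.snd (t.apply_mk_symm hy (Pi.single i 1 : Fin n → 𝕜))
    exact (h (u ∩ t.baseSet) Set.inter_subset_left (hu.inter t.open_baseSet) _
      (hs.mono Set.inter_subset_right)).contMDiffAt
        ((hu.inter t.open_baseSet).mem_nhds ⟨hx₀, hx₀t⟩)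
  have hsum : ContMDiffAt 𝓘(𝕜, Fin n → 𝕜) 𝓘(𝕜, (Fin n → 𝕜) →L[𝕜] (Fin n → 𝕜)) ∞
      (fun x ↦ ∑ i : Fin n, ContinuousLinearMap.smulRightL 𝕜 (Fin n → 𝕜) (Fin n → 𝕜)
        (ContinuousLinearMap.proj i) (t ⟨x, φ x (t.symmL 𝕜 x (Pi.single i 1))⟩).2) x₀ := by
    refine ContMDiffAt.sum fun i _ ↦ ?_
    exact (ContinuousLinearMap.contMDiff _).contMDiffAt.comp x₀ (key i)
  refine hsum.congr_of_eventuallyEq ?_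
  filter_upwards [t.open_baseSet.mem_nhds hx₀t] with x hx
  ext1 v
  conv_lhs => rw [pi_eq_sum_univ' v]
  simp [ContinuousLinearMap.inCoordinates, ← ht, t.coe_linearMapAt_of_mem hx, map_sum]

/-- A vector field whose image under a smooth field of invertible endomorphisms is smooth is
itself smooth. -/
theorem SmoothVFieldOn.of_endField_apply {φ : EndField 𝕜 n M} {X : VField 𝕜 n M} {u : Set M}
    (hu : IsOpen u)
    (hφ : ContMDiffOn 𝓘(𝕜, Fin n → 𝕜)
      (𝓘(𝕜, Fin n → 𝕜).prod 𝓘(𝕜, (Fin n → 𝕜) →L[𝕜] (Fin n → 𝕜))) ∞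
      (fun x ↦ (⟨x, φ x⟩ : TotalSpace ((Fin n → 𝕜) →L[𝕜] (Fin n → 𝕜))
        fun x ↦ TangentSpace 𝓘(𝕜, Fin n → 𝕜) x →L[𝕜] TangentSpace 𝓘(𝕜, Fin n → 𝕜) x)) u)
    (hinv : ∀ x ∈ u, Function.Injective (φ x))
    (h : SmoothVFieldOn (fun x ↦ φ x (X x)) u) : SmoothVFieldOn X u := by
  intro x₀ hx₀
  apply ContMDiffAt.contMDiffWithinAt
  have hφ₀ := (contMDiffAt_hom_bundle _).mp (hφ.contMDiffAt (hu.mem_nhds hx₀)) |>.2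
  have h₀ := (contMDiffAt_section _).mp (ContMDiffOn.contMDiffAt h (hu.mem_nhds hx₀))
  rw [contMDiffAt_section]
  simp only at hφ₀
  set t := trivializationAt (Fin n → 𝕜) (TangentSpace 𝓘(𝕜, Fin n → 𝕜) : M → Type _) x₀ with ht
  have hx₀t : x₀ ∈ t.baseSet := FiberBundle.mem_baseSet_trivializationAt' x₀
  set L : M → (Fin n → 𝕜) →L[𝕜] (Fin n → 𝕜) := fun x ↦
    ContinuousLinearMap.inCoordinates (Fin n → 𝕜) (TangentSpace 𝓘(𝕜, Fin n → 𝕜) : M → Type _)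
      (Fin n → 𝕜) (TangentSpace 𝓘(𝕜, Fin n → 𝕜) : M → Type _) x₀ x x₀ x (φ x) with hL
  -- In finite dimension injectivity suffices; smoothness then comes from that of operator
  -- inversion.
  have hLinv : ∀ x ∈ u ∩ t.baseSet, (L x).IsInvertible := by
    intro x hx
    have hinj : Function.Injective (L x) := by
      rw [hL]
      simp only
      rw [ContinuousLinearMap.inCoordinates_eq hx.2 hx.2]
      exact (t.continuousLinearEquivAt 𝕜 x hx.2).injective.comp
        ((hinv x hx.1).comp (t.continuousLinearEquivAt 𝕜 x hx.2).symm.injective)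
    exact ⟨(LinearEquiv.ofInjectiveEndo (L x : (Fin n → 𝕜) →ₗ[𝕜] (Fin n → 𝕜))
      hinj).toContinuousLinearEquiv, by ext1; rfl⟩
  have hLX : ∀ x ∈ u ∩ t.baseSet, L x (t ⟨x, X x⟩).2 = (t ⟨x, φ x (X x)⟩).2 := by
    intro x hx
    rw [hL]
    simp only
    rw [ContinuousLinearMap.inCoordinates_eq hx.2 hx.2]
    simp [← ht, hx.2]
  have hInv : ContMDiffAt 𝓘(𝕜, Fin n → 𝕜) 𝓘(𝕜, (Fin n → 𝕜) →L[𝕜] (Fin n → 𝕜)) ∞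
      (fun x ↦ (L x).inverse) x₀ :=
    ((hLinv x₀ ⟨hx₀, hx₀t⟩).contDiffAt_map_inverse).contMDiffAt.comp x₀ hφ₀
  refine (hInv.clm_apply h₀).congr_of_eventuallyEq ?_
  filter_upwards [(hu.inter t.open_baseSet).mem_nhds ⟨hx₀, hx₀t⟩] with x hx
  rw [← hLX x hx]
  obtain ⟨e, he⟩ := hLinv x hx
  rw [← he]
  simp

/-! ### Derivatives along a smooth connection. -/

section Connection

variable {cov : AffineConnection 𝕜 n M} {u : Set M} {x : M}

theorem SmoothConnection.contMDiffOn (hcov : SmoothConnection cov) (hu : IsOpen u)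
    {Y : VField 𝕜 n M} (hY : SmoothVFieldOn Y u) :
    ContMDiffOn 𝓘(𝕜, Fin n → 𝕜)
      (𝓘(𝕜, Fin n → 𝕜).prod 𝓘(𝕜, (Fin n → 𝕜) →L[𝕜] (Fin n → 𝕜))) ∞
      (fun x ↦ (⟨x, cov Y x⟩ : TotalSpace ((Fin n → 𝕜) →L[𝕜] (Fin n → 𝕜))
        fun x ↦ TangentSpace 𝓘(𝕜, Fin n → 𝕜) x →L[𝕜] TangentSpace 𝓘(𝕜, Fin n → 𝕜) x)) u :=
  (hcov u hu).contMDiff hY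

theorem SmoothConnection.nabla (hcov : SmoothConnection cov) (hu : IsOpen u)
    {X Y : VField 𝕜 n M} (hX : SmoothVFieldOn X u) (hY : SmoothVFieldOn Y u) :
    SmoothVFieldOn (nabla cov X Y) u :=
  (hcov.contMDiffOn hu hY).clm_bundle_apply hX

theorem cov_sub {Y Z : VField 𝕜 n M} (hu : IsOpen u) (hY : SmoothVFieldOn Y u)
    (hZ : SmoothVFieldOn Z u) (hx : x ∈ u) : cov (Y - Z) x = cov Y x - cov Z x := by
  rw [eq_sub_iff_add_eq, ← cov.isCovariantDerivativeOnUniv.add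
    ((hY.sub hZ).mdifferentiableAt hu hx) (hZ.mdifferentiableAt hu hx), sub_add_cancel]

end Connection

/-! ### Identities in commutative rings, to be applied in the tangent algebras. -/

/-- The pointwise identity behind the compatibility of the dual connection with the dual
product. -/
theorem dual_compatibility_identity {R : Type*} [CommRing R]
    {X Y Z U E P Q a b c₁ c₂ dXY dYX dXZ dYZ dXU dYU vX vY w s p₁ p₂ q₁ q₂ r₁ r₂ t₁ t₂ : R}
    (hUE : U * E = 1)
    (hP : P = p₁ + dXU * (Y * Z) + U * (s + dXY * Z + Y * dXZ))
    (hQ : Q = p₂ + dYU * (X * Z) + U * (s + dYX * Z + X * dYZ))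
    (hX : r₁ + dXU * E + U * vX = 0) (hY : r₂ + dYU * E + U * vY = 0)
    (ha : a = q₁ + vX * (U * Z) + X * w - X * (U * Z))
    (hb : b = q₂ + vY * (U * Z) + Y * w - Y * (U * Z))
    (h₁ : E * t₁ + q₁ = r₁ * Z) (h₂ : E * t₂ + q₂ = r₂ * Z)
    (h : Y * t₁ + p₂ = X * t₂ + p₁) :
    P - c₁ - U * (dXY - c₂) * Z - U * Y * (dXZ - a) =
      Q - c₁ - U * (dYX - c₂) * Z - U * X * (dYZ - b) := by
  linear_combination hP - hQ + U * Y * ha - U * X * hb - h + U * Y * h₁ - U * X * h₂ +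
    U * Y * Z * hX - U * X * Z * hY +
    (-Y * t₁ - dXU * Y * Z + X * t₂ + dYU * X * Z) * hUE

theorem derivation_defect_identity {R : Type*} [CommRing R]
    {Y Z W dY dZ dW N c₁ c₂ c₃ c₄ : R}
    (h₁ : N = c₁ + (c₂ + dY * Z + Y * dZ) * W + Y * Z * dW)
    (h₂ : N = c₃ + dY * (Z * W) + Y * (c₄ + dZ * W + Z * dW)) :
    Y * c₄ + c₃ = c₁ + c₂ * W := by
  linear_combination h₁ - h₂

theorem euler_identity {R : Type*} [CommRing R] {X Y dX dY vX vY v d c : R}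
    (h : d - v - (dX - vX) * Y - X * (dY - vY) = X * Y) (hd : d = c + dX * Y + X * dY) :
    v = c + vX * Y + X * vY - X * Y := by
  linear_combination hd - h

/-! ### The tangent algebras and the inverse of `E`. -/

namespace FlatFManifoldWithEuler

variable (F : FlatFManifoldWithEuler 𝕜 n M)

/-- The tangent space at `x` as a commutative ring with the product `∘`. -/
def TangentAlgebra (_ : FlatFManifoldWithEuler 𝕜 n M) (x : M) : Type _ :=
  TangentSpace 𝓘(𝕜, Fin n → 𝕜) x

instance (x : M) : AddCommGroup (F.TangentAlgebra x) :=
  inferInstanceAs (AddCommGroup (TangentSpace 𝓘(𝕜, Fin n → 𝕜) x))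

theorem mul_add' (x : M) (v w z : TangentSpace 𝓘(𝕜, Fin n → 𝕜) x) :
    F.mul x v (w + z) = F.mul x v w + F.mul x v z :=
  (F.mul x v).map_add w z

theorem add_mul' (x : M) (v w z : TangentSpace 𝓘(𝕜, Fin n → 𝕜) x) :
    F.mul x (v + w) z = F.mul x v z + F.mul x w z := by
  rw [F.mul_comm, F.mul_add', F.mul_comm, F.mul_comm x z w]

theorem zero_mul' (x : M) (v : TangentSpace 𝓘(𝕜, Fin n → 𝕜) x) : F.mul x 0 v = 0 := by
  rw [F.mul_comm]
  exact (F.mul x v).map_zero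

instance (x : M) : CommRing (F.TangentAlgebra x) where
  mul v w := F.mul x v w
  one := F.e x
  mul_assoc v w z := F.mul_assoc x v w z
  mul_comm v w := F.mul_comm x v w
  one_mul v := F.e_mul x v
  mul_one v := (F.mul_comm x v (F.e x)).trans (F.e_mul x v)
  zero_mul v := F.zero_mul' x v
  mul_zero v := (F.mul x v).map_zero
  left_distrib v w z := F.mul_add' x v w z
  right_distrib v w z := F.add_mul' x v w z
  zsmul := fun k v ↦ k • v
  zsmul_zero' v := zero_zsmul v
  zsmul_succ' k v := SubNegMonoid.zsmul_succ' k v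
  zsmul_neg' k v := SubNegMonoid.zsmul_neg' k v
  nsmul := fun k v ↦ k • v
  nsmul_zero v := zero_nsmul v
  nsmul_succ k v := succ_nsmul v k
  sub_eq_add_neg v w := sub_eq_add_neg v w
  neg_add_cancel v := neg_add_cancel v

variable {F}

theorem prodV_comm (X Y : VField 𝕜 n M) : prodV F.mul X Y = prodV F.mul Y X :=
  funext fun x ↦ F.mul_comm x _ _

theorem prodV_assoc (X Y Z : VField 𝕜 n M) :
    prodV F.mul (prodV F.mul X Y) Z = prodV F.mul X (prodV F.mul Y Z) :=
  funext fun x ↦ F.mul_assoc x _ _ _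

theorem e_prodV (X : VField 𝕜 n M) : prodV F.mul F.e X = X :=
  funext fun x ↦ F.e_mul x _

theorem prodV_eulerInv (hE : F.EulerInvertible) : prodV F.mul F.E F.eulerInv = F.e := by
  funext x
  simp only [prodV, eulerInv]
  rw [dif_pos (hE x)]
  exact (hE x).choose_spec

theorem eulerInv_prodV (hE : F.EulerInvertible) : prodV F.mul F.eulerInv F.E = F.e := by
  rw [prodV_comm, prodV_eulerInv hE]

theorem eulerInv_mul_E (hE : F.EulerInvertible) (x : M) :
    F.mul x (F.eulerInv x) (F.E x) = F.e x :=
  congrFun (eulerInv_prodV hE) x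

theorem prodV_dualMul (X Y : VField 𝕜 n M) :
    prodV F.dualMul X Y = prodV F.mul (prodV F.mul F.eulerInv X) Y := rfl

theorem dualMul_sub_left (F : FlatFManifoldWithEuler 𝕜 n M) (x : M)
    (v w z : TangentSpace 𝓘(𝕜, Fin n → 𝕜) x) :
    F.dualMul x (v - w) z = F.dualMul x v z - F.dualMul x w z := by
  rw [(F.dualMul x).map_sub]
  rfl

/-- Although chosen pointwise, `E⁻¹` solves `E ∘ V = e`, where `E ∘` is a smooth field of injective
endomorphisms. -/
theorem smooth_eulerInv (hE : F.EulerInvertible) : SmoothVFieldOn F.eulerInv Set.univ := by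
  refine SmoothVFieldOn.of_endField_apply (φ := fun x ↦ F.mul x (F.E x)) isOpen_univ
    (contMDiffOn_endField isOpen_univ fun v hv hvo X hX ↦
      F.smooth_mul v hvo F.E X (F.smooth_E.mono hv) hX) (fun x _ v w h ↦ ?_) ?_
  · have h' := congrArg (F.mul x (F.eulerInv x)) h
    rwa [← F.mul_assoc, ← F.mul_assoc, eulerInv_mul_E hE, F.e_mul, F.e_mul] at h'
  · have : (fun x ↦ F.mul x (F.E x) (F.eulerInv x)) = F.e := prodV_eulerInv hE
    rw [this]
    exact F.smooth_e

/-! ### The covariant derivative of `∘`. -/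

section Local

variable {u : Set M} {x : M} {X Y Z W : VField 𝕜 n M}

theorem smooth_prodV (hu : IsOpen u) (hX : SmoothVFieldOn X u) (hY : SmoothVFieldOn Y u) :
    SmoothVFieldOn (prodV F.mul X Y) u :=
  F.smooth_mul u hu X Y hX hY

theorem smooth_dualProd (hE : F.EulerInvertible) (hu : IsOpen u) (hX : SmoothVFieldOn X u)
    (hY : SmoothVFieldOn Y u) : SmoothVFieldOn (prodV F.dualMul X Y) u :=
  smooth_prodV hu (smooth_prodV hu ((smooth_eulerInv hE).mono (Set.subset_univ u)) hX) hY

theorem bracket_eq (hu : IsOpen u) (hX : SmoothVFieldOn X u) (hY : SmoothVFieldOn Y u)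
    (hx : x ∈ u) : bracket X Y x = nabla F.conn X Y x - nabla F.conn Y X x :=
  (F.conn.torsion_eq_zero_iff.mp F.torsion_free (hX.mdifferentiableAt hu hx)
    (hY.mdifferentiableAt hu hx)).symm

theorem nabla_prodV (X Y Z : VField 𝕜 n M) (x : M) :
    nabla F.conn X (prodV F.mul Y Z) x = nablaProd F.conn F.mul X Y Z x +
      F.mul x (nabla F.conn X Y x) (Z x) + F.mul x (Y x) (nabla F.conn X Z x) := by
  simp only [nablaProd, Pi.sub_apply, prodV]
  abel

theorem nablaProd_comm (X Y Z : VField 𝕜 n M) :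
    nablaProd F.conn F.mul X Y Z = nablaProd F.conn F.mul X Z Y := by
  simp only [nablaProd]
  rw [prodV_comm Y Z, prodV_comm _ Z, prodV_comm Y, sub_right_comm]

theorem nabla_e (X : VField 𝕜 n M) (x : M) : nabla F.conn X F.e x = 0 := by
  rw [nabla, F.e_parallel x]
  rfl

theorem nablaProd_e (X Z : VField 𝕜 n M) (x : M) :
    nablaProd F.conn F.mul X F.e Z x = 0 := by
  have h' := nabla_prodV (F := F) X F.e Z x
  rw [e_prodV, nabla_e, F.zero_mul', F.e_mul, add_zero] at h'
  exact left_eq_add.mp ((add_comm _ _).trans h'.symm).symm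

/-- Expanding `∇_X (Y ∘ Z ∘ W)` with either bracketing shows that the defect of `∇_X` as a
derivation is a Hochschild 2-cocycle. -/
theorem nablaProd_cocycle (X Y Z W : VField 𝕜 n M) (x : M) :
    F.mul x (Y x) (nablaProd F.conn F.mul X Z W x) +
        nablaProd F.conn F.mul X Y (prodV F.mul Z W) x =
      nablaProd F.conn F.mul X (prodV F.mul Y Z) W x +
        F.mul x (nablaProd F.conn F.mul X Y Z x) (W x) := by
  have h₁ := nabla_prodV (F := F) X (prodV F.mul Y Z) W x
  have h₂ := nabla_prodV (F := F) X Y (prodV F.mul Z W) x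
  rw [nabla_prodV X Y Z] at h₁
  rw [nabla_prodV X Z W, ← prodV_assoc] at h₂
  exact derivation_defect_identity (R := F.TangentAlgebra x) h₁ h₂

/-- This is `Lie_E ∘ = ∘` with every bracket written through `∇`, which is torsion-free. -/
theorem nabla_prodV_E (hu : IsOpen u) (hX : SmoothVFieldOn X u) (hY : SmoothVFieldOn Y u)
    (hx : x ∈ u) :
    nabla F.conn (prodV F.mul X Y) F.E x = nablaProd F.conn F.mul F.E X Y x +
      F.mul x (nabla F.conn X F.E x) (Y x) + F.mul x (X x) (nabla F.conn Y F.E x) -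
      F.mul x (X x) (Y x) := by
  have hEu := F.smooth_E.mono (Set.subset_univ u)
  have h := F.lie_E_mul u hu X Y hX hY x hx
  change bracket F.E (prodV F.mul X Y) x - F.mul x (bracket F.E X x) (Y x) -
    F.mul x (X x) (bracket F.E Y x) = F.mul x (X x) (Y x) at h
  rw [bracket_eq hu hEu hX hx, bracket_eq hu hEu hY hx] at h
  have h' := bracket_eq (F := F) hu hEu (smooth_prodV (F := F) hu hX hY) hx
  have h'' := nabla_prodV (F := F) F.E X Y x
  rw [h'] at h
  exact euler_identity (R := F.TangentAlgebra x) h h''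

end Local

/-! ### The explicit dual connection. -/

variable (F) in
/-- The connection `∇_X Y - ∇_(X * Y) E`. -/
def dualConnection : AffineConnection 𝕜 n M where
  toFun Y x := F.conn Y x - (F.conn F.E x).comp (F.dualMul x (Y x))
  isCovariantDerivativeOnUniv :=
    { add := by
        intro Y Z x hY hZ _
        rw [F.conn.isCovariantDerivativeOnUniv.add hY hZ, Pi.add_apply, map_add,
          ContinuousLinearMap.comp_add]
        abel
      leibniz := by
        intro Y g x hY hg _
        rw [F.conn.isCovariantDerivativeOnUniv.leibniz hY hg, Pi.smul_apply', map_smul,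
          ContinuousLinearMap.comp_smul, smul_sub]
        abel }

theorem prodV_left_comm (X Y Z : VField 𝕜 n M) :
    prodV F.mul X (prodV F.mul Y Z) = prodV F.mul Y (prodV F.mul X Z) := by
  rw [← prodV_assoc, prodV_comm X, prodV_assoc]

theorem dualProd_comm (X Y : VField 𝕜 n M) : prodV F.dualMul X Y = prodV F.dualMul Y X := by
  simp only [prodV_dualMul, prodV_comm, prodV_left_comm]

theorem dualProd_left_comm (X Y Z : VField 𝕜 n M) :
    prodV F.dualMul X (prodV F.dualMul Y Z) = prodV F.dualMul Y (prodV F.dualMul X Z) := by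
  simp only [prodV_dualMul, prodV_comm, prodV_left_comm]

theorem nabla_dualConnection (X Y : VField 𝕜 n M) :
    nabla F.dualConnection X Y =
      nabla F.conn X Y - nabla F.conn (prodV F.dualMul X Y) F.E := by
  funext x
  change F.conn Y x (X x) - F.conn F.E x (F.dualMul x (Y x) (X x)) =
    F.conn Y x (X x) - F.conn F.E x (F.dualMul x (X x) (Y x))
  rw [dualMul_apply, dualMul_apply, F.mul_assoc, F.mul_assoc, F.mul_comm x (X x)]

theorem smooth_dualConnection (hE : F.EulerInvertible) : SmoothConnection F.dualConnection := by
  refine fun u hu ↦ ⟨fun {Y} hY ↦ contMDiffOn_endField hu fun v hv hvo X hX ↦ ?_⟩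
  have hY' : SmoothVFieldOn Y v := SmoothVFieldOn.mono hY hv
  change SmoothVFieldOn (nabla F.dualConnection X Y) v
  rw [nabla_dualConnection]
  exact (F.smooth_conn.nabla hvo hX hY').sub (F.smooth_conn.nabla hvo
    (smooth_dualProd hE hvo hX hY') (F.smooth_E.mono (Set.subset_univ v)))

theorem dualConnection_E (hE : F.EulerInvertible) : IsParallel F.dualConnection F.E := by
  intro x
  ext1 v
  change F.conn F.E x v - F.conn F.E x (F.mul x (F.mul x (F.eulerInv x) (F.E x)) v) = 0
  rw [eulerInv_mul_E hE, F.e_mul, sub_self]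

theorem almostHydroEquiv_dualConnection : AlmostHydroEquiv F.conn F.dualConnection F.mul := by
  intro u hu X Y Z hX hY hZ x hx
  have h : ∀ W : VField 𝕜 n M, (fun x ↦ F.mul x (X x) (W x)) = prodV F.mul X W := fun _ ↦ rfl
  have h' : prodV F.dualMul Y (prodV F.mul X Z) = prodV F.dualMul Z (prodV F.mul X Y) := by
    simp only [prodV_dualMul, prodV_assoc, prodV_comm, prodV_left_comm]
  simp only [extCovDeriv, h, nabla_dualConnection, h']
  simp

section Local

variable {u : Set M} {x : M} {X Y Z W : VField 𝕜 n M}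

theorem dualConnection_compatible (hE : F.EulerInvertible) :
    IsCompatible F.dualConnection F.dualMul := by
  intro u hu X Y Z hX hY hZ x hx
  have hU : SmoothVFieldOn F.eulerInv u := (smooth_eulerInv hE).mono (Set.subset_univ u)
  have hEu : SmoothVFieldOn F.E u := F.smooth_E.mono (Set.subset_univ u)
  have hUE := eulerInv_prodV hE
  set U := F.eulerInv with hUdef
  have hUZ := smooth_prodV (F := F) hu hU hZ
  have hcomp := fun A B C hA hB hC ↦ F.compatible u hu A B C hA hB hC x hx
  -- expansions of the derivatives of triple products
  have hP := nabla_prodV (F := F) X U (prodV F.mul Y Z) x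
  rw [nabla_prodV X Y Z] at hP
  have hQ := nabla_prodV (F := F) Y U (prodV F.mul X Z) x
  rw [nabla_prodV Y X Z, hcomp Y X Z hY hX hZ] at hQ
  have hX' := nabla_prodV (F := F) X U F.E x
  have hY' := nabla_prodV (F := F) Y U F.E x
  rw [hUE, nabla_e] at hX' hY'
  have ha := nabla_prodV_E (F := F) hu hX hUZ hx
  have hb := nabla_prodV_E (F := F) hu hY hUZ hx
  -- Since `E ∘ U = e` and `∇e = 0`, one term of the cocycle identity drops out.
  have h₁ := nablaProd_cocycle (F := F) X F.E U Z x
  have h₂ := nablaProd_cocycle (F := F) Y F.E U Z x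
  rw [prodV_comm F.E, hUE, nablaProd_e, zero_add, nablaProd_comm X F.E U,
    hcomp X F.E _ hX hEu hUZ] at h₁
  rw [prodV_comm F.E, hUE, nablaProd_e, zero_add, nablaProd_comm Y F.E U,
    hcomp Y F.E _ hY hEu hUZ] at h₂
  -- The right-hand side is symmetric in `X`, `Y`, so the left-hand side is too; compatibility then
  -- moves `U` out of the differentiation slot.
  have h₃ := nablaProd_cocycle (F := F) U Y X Z x
  have h₄ := nablaProd_cocycle (F := F) U X Y Z x
  rw [prodV_comm Y X, nablaProd_comm U Y X] at h₃
  have h := h₃.trans h₄.symm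
  rw [hcomp U X Z hU hX hZ, hcomp U Y Z hU hY hZ,
    hcomp U Y _ hU hY (smooth_prodV hu hX hZ), hcomp U X _ hU hX (smooth_prodV hu hY hZ)] at h
  have hc₁ := dualProd_left_comm (F := F) Y X Z
  have hc₂ := dualProd_comm (F := F) Y X
  have hXZ : prodV F.dualMul X Z = prodV F.mul X (prodV F.mul U Z) := by
    rw [prodV_dualMul, prodV_assoc, prodV_left_comm]
  have hYZ : prodV F.dualMul Y Z = prodV F.mul Y (prodV F.mul U Z) := by
    rw [prodV_dualMul, prodV_assoc, prodV_left_comm]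
  have hPX : nabla F.conn X (prodV F.dualMul Y Z) x =
      nabla F.conn X (prodV F.mul U (prodV F.mul Y Z)) x := by
    rw [prodV_dualMul, prodV_assoc]
  have hQX : nabla F.conn Y (prodV F.dualMul X Z) x =
      nabla F.conn Y (prodV F.mul U (prodV F.mul X Z)) x := by
    rw [prodV_dualMul, prodV_assoc]
  simp only [nablaProd, nabla_dualConnection, hc₁, hc₂]
  rw [← hXZ] at ha
  rw [← hYZ] at hb
  rw [← hPX] at hP
  rw [← hQX] at hQ
  exact dual_compatibility_identity (R := F.TangentAlgebra x) (eulerInv_mul_E hE x) hP hQ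
    hX'.symm hY'.symm ha hb h₁ h₂ h

/-! ### The second derivative of `E` and the dual curvature. -/

/-- Without torsion, the antisymmetric part of `∇∇E` is the curvature applied to `E`. -/
theorem secondNabla_comm (hu : IsOpen u) (hX : SmoothVFieldOn X u) (hY : SmoothVFieldOn Y u)
    (hx : x ∈ u) : secondNabla F.conn F.E X Y x = secondNabla F.conn F.E Y X x := by
  have h := F.flat u hu X Y F.E hX hY (F.smooth_E.mono (Set.subset_univ u)) x hx
  have hb : nabla F.conn (bracket X Y) F.E x =
      nabla F.conn (nabla F.conn X Y) F.E x - nabla F.conn (nabla F.conn Y X) F.E x := by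
    rw [nabla, bracket_eq hu hX hY hx]
    exact (F.conn F.E x).map_sub _ _
  simp only [curvature, Pi.sub_apply, hb] at h
  simp only [secondNabla, Pi.sub_apply]
  rw [← sub_eq_zero, ← h]
  abel

theorem nabla_e_E : nabla F.conn F.e F.E = F.e := by
  funext x
  have h := bracket_eq (F := F) isOpen_univ F.smooth_e F.smooth_E (Set.mem_univ x)
  rw [F.e_bracket] at h
  rw [h, nabla_e, sub_zero]

/-- By symmetry this is `(∇∇E)(X, e)`, which vanishes because `∇_e E = e` and `∇e = 0`. -/
theorem secondNabla_e (hu : IsOpen u) (hX : SmoothVFieldOn X u) (hx : x ∈ u) :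
    secondNabla F.conn F.E F.e X x = 0 := by
  rw [secondNabla_comm hu (F.smooth_e.mono (Set.subset_univ u)) hX hx]
  rw [secondNabla, nabla_e_E, Pi.sub_apply, nabla_e, zero_sub, neg_eq_zero, nabla, nabla_e]
  exact (F.conn F.E x).map_zero

theorem curvature_dualConnection (hE : F.EulerInvertible) (hu : IsOpen u)
    (hX : SmoothVFieldOn X u) (hY : SmoothVFieldOn Y u) (hZ : SmoothVFieldOn Z u) (hx : x ∈ u) :
    curvature F.dualConnection X Y Z x =
      secondNabla F.conn F.E Y (prodV F.dualMul X Z) x -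
        secondNabla F.conn F.E X (prodV F.dualMul Y Z) x := by
  have hEu : SmoothVFieldOn F.E u := F.smooth_E.mono (Set.subset_univ u)
  have hexp : ∀ {X Y : VField 𝕜 n M}, SmoothVFieldOn X u → SmoothVFieldOn Y u →
      nabla F.dualConnection X (nabla F.dualConnection Y Z) x =
        nabla F.conn X (nabla F.conn Y Z) x -
          nabla F.conn X (nabla F.conn (prodV F.dualMul Y Z) F.E) x -
          F.conn F.E x (F.dualMul x (X x) (nabla F.dualConnection Y Z x)) := by
    intro X Y hX hY
    rw [nabla_dualConnection X, Pi.sub_apply]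
    congr 1
    rw [nabla_dualConnection Y]
    simp only [nabla]
    rw [cov_sub hu (F.smooth_conn.nabla hu hY hZ) (F.smooth_conn.nabla hu
      (smooth_dualProd hE hu hY hZ) hEu) hx]
    rfl
  have hflat := F.flat u hu X Y Z hX hY hZ x hx
  have hcomp := dualConnection_compatible hE u hu X Y Z hX hY hZ x hx
  have htors : nabla F.dualConnection X Y x - nabla F.dualConnection Y X x = bracket X Y x := by
    rw [bracket_eq hu hX hY hx, nabla_dualConnection, nabla_dualConnection, dualProd_comm Y X,
      Pi.sub_apply, Pi.sub_apply, sub_sub_sub_cancel_right]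
  have hYZ : nabla F.dualConnection X (prodV F.dualMul Y Z) x -
      nabla F.dualConnection Y (prodV F.dualMul X Z) x =
      nabla F.conn X (prodV F.dualMul Y Z) x - nabla F.conn Y (prodV F.dualMul X Z) x := by
    rw [nabla_dualConnection, nabla_dualConnection, dualProd_left_comm Y X,
      Pi.sub_apply, Pi.sub_apply, sub_sub_sub_cancel_right]
  have hbr : F.dualMul x (nabla F.dualConnection X Y x) (Z x) -
      F.dualMul x (nabla F.dualConnection Y X x) (Z x) = F.dualMul x (bracket X Y x) (Z x) := by
    rw [← htors]
    exact (F.dualMul_sub_left _ _ _ _).symm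
  -- Compatibility of `∇²` with `*` and its vanishing torsion; on the left, `∇²` may be replaced by
  -- `∇` as the corrections cancel. Applying `∇E` turns the first-order terms of `R²` into those of
  -- `∇∇E`.
  have key : nabla F.conn X (prodV F.dualMul Y Z) x - nabla F.conn Y (prodV F.dualMul X Z) x =
      F.dualMul x (bracket X Y x) (Z x) + F.dualMul x (Y x) (nabla F.dualConnection X Z x) -
        F.dualMul x (X x) (nabla F.dualConnection Y Z x) := by
    rw [← hbr, ← hYZ]
    simp only [nablaProd, Pi.sub_apply] at hcomp
    simp only [prodV] at hcomp ⊢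
    rw [sub_sub, sub_sub, sub_eq_iff_eq_add] at hcomp
    rw [hcomp]
    abel
  have hV := congrArg (F.conn F.E x) key
  rw [ContinuousLinearMap.map_sub, ContinuousLinearMap.map_sub, ContinuousLinearMap.map_add] at hV
  have hcur : nabla F.dualConnection (bracket X Y) Z x = nabla F.conn (bracket X Y) Z x -
      F.conn F.E x (F.dualMul x (bracket X Y x) (Z x)) := by
    rw [nabla_dualConnection]
    rfl
  have hs : ∀ X W : VField 𝕜 n M, secondNabla F.conn F.E X W x =
      nabla F.conn X (nabla F.conn W F.E) x - F.conn F.E x (nabla F.conn X W x) := fun _ _ ↦ rfl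
  simp only [curvature, Pi.sub_apply] at hflat
  simp only [curvature, Pi.sub_apply, hexp hX hY, hexp hY hX, hs, hcur]
  rw [sub_eq_iff_eq_add] at hflat hV
  rw [sub_eq_iff_eq_add] at hflat
  rw [hflat, hV]
  abel

end Local

/-! ### Uniqueness and the flatness criterion. -/

/-- Differentiability of `Y` at `x` is needed: the axioms of a covariant derivative do not constrain
its value on other fields. -/
theorem IsDualConnection.eq (hE : F.EulerInvertible) {cov₂ cov₂' : AffineConnection 𝕜 n M}
    (h : F.IsDualConnection cov₂) (h' : F.IsDualConnection cov₂') {Y : VField 𝕜 n M} {x : M}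
    (hY : MDifferentiableAt 𝓘(𝕜, Fin n → 𝕜) (𝓘(𝕜, Fin n → 𝕜).prod 𝓘(𝕜, Fin n → 𝕜))
      (fun y ↦ TotalSpace.mk' (Fin n → 𝕜) y (Y y)) x) : cov₂ Y x = cov₂' Y x := by
  set A := IsCovariantDerivativeOn.difference cov₂.isCovariantDerivativeOnUniv
    cov₂'.isCovariantDerivativeOnUniv x with hA
  have hAapp : ∀ {W : VField 𝕜 n M}, MDifferentiableAt 𝓘(𝕜, Fin n → 𝕜)
      (𝓘(𝕜, Fin n → 𝕜).prod 𝓘(𝕜, Fin n → 𝕜)) (fun y ↦ TotalSpace.mk' (Fin n → 𝕜) y (W y)) x →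
      A (W x) = cov₂ W x - cov₂' W x := fun hW ↦
    IsCovariantDerivativeOn.difference_apply cov₂.isCovariantDerivativeOnUniv
      cov₂'.isCovariantDerivativeOnUniv (Set.mem_univ x) hW
  -- the difference tensor satisfies `A (a ∘ c) b = A (a ∘ b) c`
  have hsymm : ∀ a b c, A (F.mul x a c) b = A (F.mul x a b) c := by
    intro a b c
    obtain ⟨u₁, hu₁, hx₁, X, hX, rfl⟩ := exists_smoothVFieldOn_eq x a
    obtain ⟨u₂, hu₂, hx₂, Y, hY, rfl⟩ := exists_smoothVFieldOn_eq x b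
    obtain ⟨u₃, hu₃, hx₃, Z, hZ, rfl⟩ := exists_smoothVFieldOn_eq x c
    have hu := (hu₁.inter hu₂).inter hu₃
    have hx : x ∈ u₁ ∩ u₂ ∩ u₃ := ⟨⟨hx₁, hx₂⟩, hx₃⟩
    replace hX := hX.mono (v := u₁ ∩ u₂ ∩ u₃) fun _ h ↦ h.1.1
    replace hY := hY.mono (v := u₁ ∩ u₂ ∩ u₃) fun _ h ↦ h.1.2
    replace hZ := hZ.mono (v := u₁ ∩ u₂ ∩ u₃) fun _ h ↦ h.2
    have e := h.almostHydroEquiv _ hu X Y Z hX hY hZ x hx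
    have e' := h'.almostHydroEquiv _ hu X Y Z hX hY hZ x hx
    have hXZ := hAapp ((smooth_prodV (F := F) hu hX hZ).mdifferentiableAt hu hx)
    have hXY := hAapp ((smooth_prodV (F := F) hu hX hY).mdifferentiableAt hu hx)
    simp only [prodV] at hXZ hXY
    rw [hXZ, hXY, sub_apply, sub_apply]
    have e'' := (sub_eq_zero.mp e).symm.trans (sub_eq_zero.mp e')
    simp only [extCovDeriv, Pi.sub_apply, nabla, sub_left_inj] at e''
    rw [sub_eq_sub_iff_sub_eq_sub] at e''
    exact e''
  have hAE : A (F.E x) = 0 := by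
    rw [hAapp (F.smooth_E.mdifferentiableAt isOpen_univ (Set.mem_univ x)), h.E_parallel,
      h'.E_parallel, sub_self]
  have hsymm' : ∀ b c, A c b = A b c := fun b c ↦ by
    simpa only [F.e_mul] using hsymm (F.e x) b c
  have hmul_e : ∀ a, F.mul x a (F.e x) = a := fun a ↦ by rw [F.mul_comm, F.e_mul]
  -- Take `a = E`, `b` replaced by `E⁻¹ ∘ b`, `c = e`: then `0 = A(E)(E⁻¹ ∘ b) = A(b) e = A(e) b`.
  have hAe : ∀ b, A (F.e x) b = 0 := fun b ↦ by
    have e := hsymm (F.E x) (F.mul x (F.eulerInv x) b) (F.e x)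
    rw [hmul_e, hAE, ← F.mul_assoc, F.mul_comm x (F.E x), eulerInv_mul_E hE, F.e_mul,
      hsymm'] at e
    exact e.symm
  have hA0 : A (Y x) = 0 := by
    ext1 b
    have e := hsymm (Y x) b (F.e x)
    rw [hmul_e, hsymm' (F.e x), hAe] at e
    exact e
  rw [← sub_eq_zero, ← hAapp hY, hA0]

theorem isDualConnection_dualConnection (hE : F.EulerInvertible) :
    F.IsDualConnection F.dualConnection where
  smooth := smooth_dualConnection hE
  E_parallel := dualConnection_E hE
  compatible := dualConnection_compatible hE
  almostHydroEquiv := almostHydroEquiv_dualConnection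

theorem IsDualConnection.curvature_eq (hE : F.EulerInvertible) {cov₂ : AffineConnection 𝕜 n M}
    (h : F.IsDualConnection cov₂) {u : Set M} {x : M} {X Y Z : VField 𝕜 n M} (hu : IsOpen u)
    (hX : SmoothVFieldOn X u) (hY : SmoothVFieldOn Y u) (hZ : SmoothVFieldOn Z u) (hx : x ∈ u) :
    curvature cov₂ X Y Z x = secondNabla F.conn F.E Y (prodV F.dualMul X Z) x -
        secondNabla F.conn F.E X (prodV F.dualMul Y Z) x := by
  rw [← curvature_dualConnection hE hu hX hY hZ hx]
  have hd := isDualConnection_dualConnection hE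
  have hnabla : ∀ {W V : VField 𝕜 n M} {y : M}, SmoothVFieldOn V u → y ∈ u →
      nabla cov₂ W V y = nabla F.dualConnection W V y := fun hV hy ↦ by
    rw [nabla, nabla, h.eq hE hd (hV.mdifferentiableAt hu hy)]
  have hnabla₂ : ∀ {W V : VField 𝕜 n M}, SmoothVFieldOn V u →
      nabla cov₂ W (nabla cov₂ V Z) x =
        nabla F.dualConnection W (nabla F.dualConnection V Z) x := fun {W V} hV ↦ by
    -- The inner derivatives are known to agree only on `u`, so the outer one uses locality.
    rw [hnabla (h.smooth.nabla hu hV hZ) hx, nabla, nabla,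
      F.dualConnection.isCovariantDerivativeOnUniv.congr_of_eventuallyEq
        ((h.smooth.nabla hu hV hZ).mdifferentiableAt hu hx)
        ((hd.smooth.nabla hu hV hZ).mdifferentiableAt hu hx) Filter.univ_mem]
    filter_upwards [hu.mem_nhds hx] with y hy using hnabla hZ hy
  simp only [curvature, Pi.sub_apply, hnabla₂ hX, hnabla₂ hY, hnabla hZ hx]

theorem IsDualConnection.isFlat_iff (hE : F.EulerInvertible) {cov₂ : AffineConnection 𝕜 n M}
    (h : F.IsDualConnection cov₂) : IsFlat cov₂ ↔ IsLinearVField F.conn F.E := by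
  constructor
  · intro hflat u hu X Z hX hZ x hx
    have he : SmoothVFieldOn F.e u := F.smooth_e.mono (Set.subset_univ u)
    have hEZ := smooth_prodV (F := F) hu (F.smooth_E.mono (Set.subset_univ u)) hZ
    have hc : ∀ W : VField 𝕜 n M, prodV F.dualMul W (prodV F.mul F.E Z) = prodV F.mul W Z := by
      intro W
      rw [prodV_dualMul, prodV_assoc, prodV_left_comm W, ← prodV_assoc, eulerInv_prodV hE, e_prodV]
    -- The factor `E` cancels the `E⁻¹` in `*`, so that `R²(X, e)(E ∘ Z) = -(∇∇E)(X, Z)`.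
    have hR := hflat u hu X F.e (prodV F.mul F.E Z) hX he hEZ x hx
    rw [h.curvature_eq hE hu hX he hEZ hx, hc, hc, e_prodV,
      secondNabla_e hu (smooth_prodV hu hX hZ) hx, zero_sub, neg_eq_zero] at hR
    exact hR
  · intro hlin u hu X Y Z hX hY hZ x hx
    rw [h.curvature_eq hE hu hX hY hZ hx, hlin u hu Y _ hY (smooth_dualProd hE hu hX hZ) x hx,
      hlin u hu X _ hX (smooth_dualProd hE hu hY hZ) x hx, sub_zero]

end FlatFManifoldWithEuler

end AlmostDuality

end

theorem mainTheorem5 {𝕜 : Type*} [RCLike 𝕜] {n : ℕ}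
    {M : Type*} [TopologicalSpace M] [ChartedSpace (Fin n → 𝕜) M]
    [IsManifold 𝓘(𝕜, Fin n → 𝕜) ∞ M]
    (F : AlmostDuality.FlatFManifoldWithEuler 𝕜 n M)
    (hss : AlmostDuality.IsSemisimple F.mul)
    (hE : F.EulerInvertible) :
    (∃ cov₂ : AlmostDuality.AffineConnection 𝕜 n M, F.IsDualConnection cov₂) ∧
    (∀ cov₂ cov₂' : AlmostDuality.AffineConnection 𝕜 n M,
      F.IsDualConnection cov₂ → F.IsDualConnection cov₂' →
      ∀ (Y : AlmostDuality.VField 𝕜 n M) (x : M),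
        MDifferentiableAt 𝓘(𝕜, Fin n → 𝕜) (𝓘(𝕜, Fin n → 𝕜).prod 𝓘(𝕜, Fin n → 𝕜))
          (fun y ↦ TotalSpace.mk' (Fin n → 𝕜) y (Y y)) x →
        cov₂ Y x = cov₂' Y x) ∧
    (∀ cov₂ : AlmostDuality.AffineConnection 𝕜 n M, F.IsDualConnection cov₂ →
      (AlmostDuality.IsFlat cov₂ ↔ AlmostDuality.IsLinearVField F.conn F.E)) :=
  ⟨⟨F.dualConnection, AlmostDuality.FlatFManifoldWithEuler.isDualConnection_dualConnection hE⟩,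
    fun _ _ h h' _ _ hY ↦ h.eq hE h' hY, fun _ h ↦ h.isFlat_iff hE⟩
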